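/- A presymplectic Abelian group is an Abelian group $G$ with an antisymmetric bi-homomorphism $\sigma: G\times G\to\mathbb{T}=\mathbb{R}/\mathbb{Z}$. Its Weyl algebra $\mathcal{A}(G)$ is the unital complex $*$-algebra with linear basis $\{W(g)\}_{g\in G}$, unit $W(0)$, and relations $W(g)^*=W(-g)$, $W(g)W(h)=e^{2\pi i\,\sigma(g,h)}W(g+h)$. Let $\mathcal{B}(G)$ be the Banach $*$-algebra obtained by completing $\mathcal{A}(G)$ in the norm $\big\|\sum_j\alpha_jW(g_j)\big\|_1=\sum_j|\alpha_j|$ ($g_j$ pairwise distinct). For a unital Banach $*$-algebra $B$, let $\mathcal{C}^*(B)$ be its enveloping C$^*$-algebra, i.e. the Hausdorff completion of $B$ in its largest C$^*$-seminorm. For unital C$^*$-algebras $C_1,C_2$, let $C_1\check\otimes C_2$ be their maximal C$^*$-tensor product, i.e. the completion of the algebraic tensor product $C_1\otimes C_2$ in the least upper bound of all C$^*$-seminorms $p$ with $p(c_1\otimes c_2)\le\|c_1\|\,\|c_2\|$. Denote the image of $W(g)$ in $\mathcal{C}^*(\mathcal{B}(G))$ again by $W(g)$. **Proposition.** Let $(G_1,\sigma_1)$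 and $(G_2,\sigma_2)$ be presymplectic Abelian groups, and equip $G_1\oplus G_2$ with $\sigma\big((g_1,g_2),(g_1',g_2')\big)=\sigma_1(g_1,g_1')+\sigma_2(g_2,g_2')$. Then there is a canonical isomorphism of C$^*$-algebras $$\Phi:\ \mathcal{C}^*(\mathcal{B}(G_1\oplus G_2))\ \xrightarrow{\ \simeq\ }\ \mathcal{C}^*(\mathcal{B}(G_1))\,\check\otimes\,\mathcal{C}^*(\mathcal{B}(G_2)),$$ namely there is exactly one $*$-isomorphism $\Phi$ such that $\Phi(W(g_1,g_2))=W(g_1)\otimes W(g_2)$ for all $g_1\in G_1$, $g_2\in G_2$. -/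

import Mathlib

open scoped TensorProduct

noncomputable section

/-! ### Star structure on the completion of a seminormed star ring -/

namespace UniformSpace.Completion

section StarCompletion

variable {A : Type*} [SeminormedRing A] [StarRing A]

/-- The involution of a seminormed `*`-ring extends by continuity to the completion. -/
instance instStarCompletion : Star (Completion A) :=
  ⟨Completion.map (star : A → A)⟩

theorem continuous_star_completion : Continuous (star : Completion A → Completion A) :=
  Completion.continuous_map

variable [NormedStarGroup A]

theorem coe_star_completion (a : A) : ((star a : A) : Completion A) = star (a : Completion A) :=
  (Completion.map_coe (star_isometry (E := A)).uniformContinuous a).symm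

instance instStarRingCompletion : StarRing (Completion A) where
  star_involutive x := by
    induction x using Completion.induction_on with
    | hp =>
      exact isClosed_eq (continuous_star_completion.comp continuous_star_completion) continuous_id
    | ih a => rw [← coe_star_completion, ← coe_star_completion, star_star]
  star_mul x y := by
    induction x, y using Completion.induction_on₂ with
    | hp =>
      exact isClosed_eq (continuous_star_completion.comp continuous_mul)
        ((continuous_star_completion.comp continuous_snd).mul
          (continuous_star_completion.comp continuous_fst))
    | ih a b =>
      rw [← coe_mul, ← coe_star_completion, star_mul, coe_mul, coe_star_completion,
        coe_star_completion]
  star_add x y := by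
    induction x, y using Completion.induction_on₂ with
    | hp =>
      exact isClosed_eq (continuous_star_completion.comp continuous_add)
        ((continuous_star_completion.comp continuous_fst).add
          (continuous_star_completion.comp continuous_snd))
    | ih a b =>
      rw [← coe_add, ← coe_star_completion, star_add, coe_add, coe_star_completion,
        coe_star_completion]

instance instNormedStarGroupCompletion : NormedStarGroup (Completion A) where
  norm_star_le x := by
    induction x using Completion.induction_on with
    | hp => exact isClosed_le (continuous_norm.comp continuous_star_completion) continuous_norm
    | ih a => rw [← coe_star_completion, norm_coe, norm_coe, norm_star]

instance instNormedAlgebraCompletion [NormedAlgebra ℂ A] : NormedAlgebra ℂ (Completion A) where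
  norm_smul_le := norm_smul_le

instance instStarModuleCompletion [NormedAlgebra ℂ A] [StarModule ℂ A] :
    StarModule ℂ (Completion A) where
  star_smul c x := by
    induction x using Completion.induction_on with
    | hp =>
      exact isClosed_eq (continuous_star_completion.comp (continuous_const_smul c))
        (continuous_star_completion.const_smul (star c))
    | ih a =>
      rw [← coe_smul, ← coe_star_completion, star_smul, coe_smul, coe_star_completion]

end StarCompletion

end UniformSpace.Completion

/-! ### C⋆-seminorms, their suprema, and the C⋆-algebra defined by a C⋆-seminorm -/

/-- A C⋆-seminorm on a complex unital `*`-algebra: a submultiplicative seminorm with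
`p (a⋆ a) = p(a)²`. -/
structure CStarSeminorm (A : Type*) [Ring A] [StarRing A] [Algebra ℂ A] extends
    Seminorm ℂ A where
  mul_le' : ∀ a b : A, toFun (a * b) ≤ toFun a * toFun b
  star_mul_self' : ∀ a : A, toFun (star a * a) = toFun a ^ 2

namespace CStarSeminorm

section General

variable {A : Type*} [Ring A] [StarRing A] [Algebra ℂ A]

instance instCoeFunCStarSeminorm : CoeFun (CStarSeminorm A) (fun _ => A → ℝ) :=
  ⟨fun p => p.toFun⟩

theorem nonneg (p : CStarSeminorm A) (a : A) : 0 ≤ p a := apply_nonneg p.toSeminorm a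

theorem star_le (p : CStarSeminorm A) (a : A) : p (star a) ≤ p a := by
  rcases (p.nonneg (star a)).eq_or_lt with h | h
  · rw [← h]; exact p.nonneg a
  · have h1 := p.star_mul_self' (star a)
    have h2 := p.mul_le' (star (star a)) (star a)
    rw [h1, star_star] at h2
    nlinarith

/-- The zero C⋆-seminorm. -/
def zeroSeminorm : CStarSeminorm A where
  toSeminorm := 0
  mul_le' a b := by change (0 : ℝ) ≤ 0 * 0; simp
  star_mul_self' a := by change (0 : ℝ) = 0 ^ 2; simp

/-- The least upper bound of a non-empty, pointwise bounded set of C⋆-seminorms. -/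
def lub (S : Set (CStarSeminorm A)) (hne : S.Nonempty)
    (hbd : ∀ a, BddAbove (Set.range fun p : S => (p : CStarSeminorm A) a)) :
    CStarSeminorm A where
  toFun a := ⨆ p : S, (p : CStarSeminorm A) a
  map_zero' := by
    have : Nonempty S := hne.to_subtype
    have h : ∀ p : S, (p : CStarSeminorm A) 0 = 0 := fun p => map_zero p.1.toSeminorm
    simp only [h, ciSup_const]
  add_le' a b := by
    have : Nonempty S := hne.to_subtype
    exact ciSup_le fun p => (map_add_le_add p.1.toSeminorm a b).trans
      (add_le_add (le_ciSup (hbd a) p) (le_ciSup (hbd b) p))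
  neg' a := by
    have h : ∀ p : S, (p : CStarSeminorm A) (-a) = (p : CStarSeminorm A) a :=
      fun p => map_neg_eq_map p.1.toSeminorm a
    simp only [h]
  smul' c a := by
    have h : ∀ p : S, (p : CStarSeminorm A) (c • a) = ‖c‖ * (p : CStarSeminorm A) a :=
      fun p => map_smul_eq_mul p.1.toSeminorm c a
    simp only [h]
    exact (Real.mul_iSup_of_nonneg (norm_nonneg c) _).symm
  mul_le' a b := by
    have : Nonempty S := hne.to_subtype
    exact ciSup_le fun p => (p.1.mul_le' a b).trans
      (mul_le_mul (le_ciSup (hbd a) p) (le_ciSup (hbd b) p) (p.1.nonneg b)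
        ((p.1.nonneg a).trans (le_ciSup (hbd a) p)))
  star_mul_self' a := by
    have : Nonempty S := hne.to_subtype
    rw [Real.iSup_pow fun p : S => p.1.nonneg a]
    exact iSup_congr fun p => p.1.star_mul_self' a

/-- A copy of `A`, carrying the topology of the C⋆-seminorm `p`. -/
def Carrier (_p : CStarSeminorm A) : Type _ := A

variable (p : CStarSeminorm A)

instance instRingCarrier : Ring p.Carrier := inferInstanceAs (Ring A)

instance instStarRingCarrier : StarRing p.Carrier := inferInstanceAs (StarRing A)

instance instAlgebraCarrier : Algebra ℂ p.Carrier := inferInstanceAs (Algebra ℂ A)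

instance instStarModuleCarrier [StarModule ℂ A] : StarModule ℂ p.Carrier :=
  inferInstanceAs (StarModule ℂ A)

instance instSeminormedRingCarrier : SeminormedRing p.Carrier :=
  { p.instRingCarrier,
    (AddGroupSeminorm.toSeminormedAddCommGroup (E := p.Carrier)
      p.toSeminorm.toAddGroupSeminorm) with
    norm_mul_le := p.mul_le' }

instance instNormedAlgebraCarrier : NormedAlgebra ℂ p.Carrier :=
  { p.instAlgebraCarrier with
    norm_smul_le := fun c a => (p.smul' c a).le }

instance instNormedStarGroupCarrier : NormedStarGroup p.Carrier where
  norm_star_le := p.star_le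

/-- The C⋆-algebra defined by a C⋆-seminorm `p` on `A`: the Hausdorff completion of `A` with
respect to `p`, i.e. the completion of the quotient of `A` by the null space of `p`. -/
def CStarCompletion : Type _ := UniformSpace.Completion p.Carrier

instance instNormedRingCStarCompletion : NormedRing p.CStarCompletion :=
  inferInstanceAs (NormedRing (UniformSpace.Completion p.Carrier))

instance instStarRingCStarCompletion : StarRing p.CStarCompletion :=
  inferInstanceAs (StarRing (UniformSpace.Completion p.Carrier))

instance instCompleteSpaceCStarCompletion : CompleteSpace p.CStarCompletion :=
  inferInstanceAs (CompleteSpace (UniformSpace.Completion p.Carrier))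

instance instNormedAlgebraCStarCompletion : NormedAlgebra ℂ p.CStarCompletion :=
  inferInstanceAs (NormedAlgebra ℂ (UniformSpace.Completion p.Carrier))

instance instStarModuleCStarCompletion [StarModule ℂ A] : StarModule ℂ p.CStarCompletion :=
  inferInstanceAs (StarModule ℂ (UniformSpace.Completion p.Carrier))

theorem cstar_identity_le (x : UniformSpace.Completion p.Carrier) : ‖x‖ * ‖x‖ ≤ ‖star x * x‖ := by
  induction x using UniformSpace.Completion.induction_on with
  | hp =>
    exact isClosed_le (continuous_norm.mul continuous_norm)
      (continuous_norm.comp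
        (UniformSpace.Completion.continuous_star_completion.mul continuous_id))
  | ih a =>
    rw [← UniformSpace.Completion.coe_star_completion, ← UniformSpace.Completion.coe_mul,
      UniformSpace.Completion.norm_coe, UniformSpace.Completion.norm_coe, ← sq]
    exact (p.star_mul_self' a).ge

instance instCStarRingCStarCompletion : CStarRing p.CStarCompletion where
  norm_mul_self_le := p.cstar_identity_le

instance instCStarAlgebraCStarCompletion [StarModule ℂ A] : CStarAlgebra p.CStarCompletion where

/-- The element of the completion given by an element of `A`. -/
def ofElem (a : A) : p.CStarCompletion :=
  UniformSpace.Completion.coe' (α := p.Carrier) a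

theorem norm_ofElem (a : A) : ‖p.ofElem a‖ = p a := UniformSpace.Completion.norm_coe (E := p.Carrier) a

/-- The canonical `*`-homomorphism from `A` to the C⋆-algebra defined by `p`. -/
def toCompletion : A →⋆ₐ[ℂ] p.CStarCompletion where
  toFun := p.ofElem
  map_one' := UniformSpace.Completion.coe_one p.Carrier
  map_mul' a b := UniformSpace.Completion.coe_mul (α := p.Carrier) a b
  map_zero' := UniformSpace.Completion.coe_zero (α := p.Carrier)
  map_add' a b := UniformSpace.Completion.coe_add (α := p.Carrier) a b
  commutes' _ := rfl
  map_star' a := UniformSpace.Completion.coe_star_completion (A := p.Carrier) a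

end General

end CStarSeminorm

/-! ### The enveloping C⋆-algebra of a unital Banach `*`-algebra -/

section Envelope

variable (B : Type*) [NormedRing B] [StarRing B] [NormedAlgebra ℂ B]

/-- The largest C⋆-seminorm on a unital Banach `*`-algebra (the Gelfand–Naimark seminorm): the
least upper bound of all C⋆-seminorms dominated by the norm. -/
def gelfandNaimarkSeminorm : CStarSeminorm B :=
  CStarSeminorm.lub {p : CStarSeminorm B | ∀ b, p b ≤ ‖b‖}
    ⟨CStarSeminorm.zeroSeminorm, fun b => norm_nonneg b⟩
    (fun b => ⟨‖b‖, by rintro _ ⟨p, rfl⟩; exact p.2 b⟩)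

/-- The enveloping C⋆-algebra `C⋆(B)` of a unital Banach `*`-algebra `B`: the Hausdorff
completion of `B` with respect to its largest C⋆-seminorm. -/
abbrev EnvelopingCStarAlgebra : Type _ := (gelfandNaimarkSeminorm B).CStarCompletion

variable {B} in
/-- The canonical `*`-homomorphism `B → C⋆(B)`. -/
abbrev toEnveloping : B →⋆ₐ[ℂ] EnvelopingCStarAlgebra B :=
  (gelfandNaimarkSeminorm B).toCompletion

end Envelope

/-! ### The maximal tensor product of unital C⋆-algebras -/

section MaxTensor

variable (C₁ C₂ : Type*) [CStarAlgebra C₁] [CStarAlgebra C₂]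

/-- The least upper bound of all C⋆-seminorms `p` on the algebraic tensor product `C₁ ⊗ C₂` which
are subcross, i.e. `p (c₁ ⊗ c₂) ≤ ‖c₁‖ ‖c₂‖`. -/
def maxTensorSeminorm : CStarSeminorm (C₁ ⊗[ℂ] C₂) :=
  CStarSeminorm.lub
    {p : CStarSeminorm (C₁ ⊗[ℂ] C₂) | ∀ c₁ c₂, p (c₁ ⊗ₜ[ℂ] c₂) ≤ ‖c₁‖ * ‖c₂‖}
    ⟨CStarSeminorm.zeroSeminorm, fun c₁ c₂ => mul_nonneg (norm_nonneg c₁) (norm_nonneg c₂)⟩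
    (fun t => by
      induction t using TensorProduct.induction_on with
      | zero =>
        exact ⟨0, by rintro _ ⟨p, rfl⟩; exact (map_zero p.1.toSeminorm).le⟩
      | tmul c₁ c₂ => exact ⟨‖c₁‖ * ‖c₂‖, by rintro _ ⟨p, rfl⟩; exact p.2 c₁ c₂⟩
      | add s t hs ht =>
        obtain ⟨M, hM⟩ := hs
        obtain ⟨N, hN⟩ := ht
        exact ⟨M + N, by
          rintro _ ⟨p, rfl⟩
          exact (map_add_le_add p.1.toSeminorm s t).trans
            (add_le_add (hM ⟨p, rfl⟩) (hN ⟨p, rfl⟩))⟩)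

/-- The maximal C⋆-tensor product of two unital C⋆-algebras. -/
abbrev MaxTensorProduct : Type _ := (maxTensorSeminorm C₁ C₂).CStarCompletion

variable {C₁ C₂} in
/-- The elementary tensor `c₁ ⊗ c₂` in the maximal C⋆-tensor product. -/
abbrev maxTmul (c₁ : C₁) (c₂ : C₂) : MaxTensorProduct C₁ C₂ :=
  (maxTensorSeminorm C₁ C₂).toCompletion (c₁ ⊗ₜ[ℂ] c₂)

end MaxTensor

/-! ### Presymplectic Abelian groups and their Weyl algebras -/

/-- A presymplectic form on an Abelian group `G`: an antisymmetric bi-homomorphism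
`σ : G × G → 𝕋 = ℝ / ℤ`. -/
structure PresymplecticForm (G : Type*) [AddCommGroup G] where
  toBihom : G →+ G →+ UnitAddCircle
  antisymm' : ∀ g h, toBihom g h = -toBihom h g

namespace PresymplecticForm

variable {G G₁ G₂ : Type*} [AddCommGroup G] [AddCommGroup G₁] [AddCommGroup G₂]

/-- The orthogonal sum `σ₁ ⊕ σ₂` on `G₁ ⊕ G₂`:
`σ ((g₁, g₂), (h₁, h₂)) = σ₁ (g₁, h₁) + σ₂ (g₂, h₂)`. -/
def orthogonalSum (σ₁ : PresymplecticForm G₁) (σ₂ : PresymplecticForm G₂) :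
    PresymplecticForm (G₁ × G₂) where
  toBihom := AddMonoidHom.mk' (fun x => AddMonoidHom.mk' (fun y => σ₁.toBihom x.1 y.1 + σ₂.toBihom x.2 y.2)
      (fun y z => by simp only [Prod.fst_add, Prod.snd_add, map_add]; abel))
    (fun x y => by
      refine AddMonoidHom.ext fun z => ?_
      simp only [AddMonoidHom.mk'_apply, AddMonoidHom.add_apply, Prod.fst_add, Prod.snd_add,
        map_add]
      abel)
  antisymm' x y := by
    change σ₁.toBihom x.1 y.1 + σ₂.toBihom x.2 y.2 =
      -(σ₁.toBihom y.1 x.1 + σ₂.toBihom y.2 x.2)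
    rw [σ₁.antisymm' x.1, σ₂.antisymm' x.2, neg_add]

theorem orthogonalSum_apply (σ₁ : PresymplecticForm G₁) (σ₂ : PresymplecticForm G₂)
    (x y : G₁ × G₂) :
    (σ₁.orthogonalSum σ₂).toBihom x y = σ₁.toBihom x.1 y.1 + σ₂.toBihom x.2 y.2 := rfl

/-- The phase `exp (2 π i σ(g, h))`. -/
def phase (σ : PresymplecticForm G) (g h : G) : ℂ := (AddCircle.toCircle (σ.toBihom g h) : ℂ)

variable (σ : PresymplecticForm G)

theorem phase_of_coe (g h : G) (t : ℝ) (ht : σ.toBihom g h = (t : UnitAddCircle)) :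
    σ.phase g h = Complex.exp (2 * Real.pi * Complex.I * t) := by
  rw [phase, ht, AddCircle.toCircle_apply_mk, Circle.coe_exp]
  congr 1
  push_cast
  ring

theorem phase_add_left (a b c : G) : σ.phase (a + b) c = σ.phase a c * σ.phase b c := by
  simp [phase, AddCircle.toCircle_add]

theorem phase_add_right (a b c : G) : σ.phase a (b + c) = σ.phase a b * σ.phase a c := by
  simp [phase, AddCircle.toCircle_add]

theorem phase_zero_left (a : G) : σ.phase 0 a = 1 := by simp [phase]

theorem phase_zero_right (a : G) : σ.phase a 0 = 1 := by simp [phase]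

theorem norm_phase (a b : G) : ‖σ.phase a b‖ = 1 := Circle.norm_coe _

theorem star_phase (a b : G) : star (σ.phase a b) = σ.phase b a := by
  rw [phase, phase, σ.antisymm' b a, AddCircle.toCircle_neg, Circle.coe_inv_eq_conj]
  rfl

theorem phase_neg_neg (a b : G) : σ.phase (-a) (-b) = σ.phase a b := by
  simp [phase]

end PresymplecticForm

/-- The underlying vector space of the Weyl `*`-algebra `𝒜(G)` of a presymplectic Abelian group
`(G, σ)`: finite formal combinations of the symbols `W(g)`, `g ∈ G`. -/
def WeylAlgebra {G : Type*} [AddCommGroup G] (_σ : PresymplecticForm G) : Type _ := G →₀ ℂ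

namespace WeylAlgebra

variable {G : Type*} [AddCommGroup G] (σ : PresymplecticForm G)

instance instAddCommGroupWeyl : AddCommGroup (WeylAlgebra σ) :=
  inferInstanceAs (AddCommGroup (G →₀ ℂ))

instance instModuleWeyl : Module ℂ (WeylAlgebra σ) := inferInstanceAs (Module ℂ (G →₀ ℂ))

/-- The generator `W(g)` of the Weyl algebra. -/
def W (g : G) : WeylAlgebra σ := (Finsupp.single g 1 : G →₀ ℂ)

variable {σ} in
theorem induction_W {P : WeylAlgebra σ → Prop} (h0 : P 0)
    (hadd : ∀ x y, P x → P y → P (x + y)) (hW : ∀ (c : ℂ) g, P (c • W σ g)) (x : WeylAlgebra σ) :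
    P x := by
  refine Finsupp.induction_linear (motive := P) x h0 (fun f g hf hg => hadd f g hf hg) ?_
  intro g c
  have h := hW c g
  have e : (c • W σ g : WeylAlgebra σ) = (Finsupp.single g c : G →₀ ℂ) := by
    change c • (Finsupp.single g 1 : G →₀ ℂ) = _
    simp
  rwa [e] at h

/-- The coefficients of an element of the Weyl algebra with respect to the basis `W(g)`. -/
def coeff (x : WeylAlgebra σ) : G →₀ ℂ := x

/-- The bilinear extension of `W(g) W(h) = exp (2 π i σ(g, h)) W(g + h)`. -/
def mulLin : WeylAlgebra σ →ₗ[ℂ] WeylAlgebra σ →ₗ[ℂ] WeylAlgebra σ :=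
  Finsupp.linearCombination ℂ fun g =>
    (Finsupp.linearCombination ℂ fun h => σ.phase g h • W σ (g + h) :
      (G →₀ ℂ) →ₗ[ℂ] WeylAlgebra σ)

theorem mulLin_W (g h : G) : mulLin σ (W σ g) (W σ h) = σ.phase g h • W σ (g + h) := by
  have h1 : mulLin σ (W σ g) = (Finsupp.linearCombination ℂ fun h => σ.phase g h • W σ (g + h) :
      (G →₀ ℂ) →ₗ[ℂ] WeylAlgebra σ) :=
    (Finsupp.linearCombination_single ℂ 1 g).trans (one_smul _ _)
  rw [h1]
  exact (Finsupp.linearCombination_single ℂ 1 h).trans (one_smul _ _)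

theorem mulLin_assoc (x y z : WeylAlgebra σ) :
    mulLin σ (mulLin σ x y) z = mulLin σ x (mulLin σ y z) := by
  induction x using induction_W with
  | h0 => simp
  | hadd x x' hx hx' => simp [hx, hx']
  | hW c g =>
    induction y using induction_W with
    | h0 => simp
    | hadd y y' hy hy' =>
      simp only [map_add, LinearMap.add_apply] at *
      rw [hy, hy']
    | hW d h =>
      induction z using induction_W with
      | h0 => simp
      | hadd z z' hz hz' =>
        simp only [map_add] at *
        rw [hz, hz']
      | hW e k =>
        simp only [map_smul, LinearMap.smul_apply, mulLin_W, smul_smul,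
          σ.phase_add_left, σ.phase_add_right, add_assoc]
        congr 1
        ring

theorem mulLin_one (x : WeylAlgebra σ) : mulLin σ x (W σ 0) = x := by
  induction x using induction_W with
  | h0 => simp
  | hadd x y hx hy => rw [map_add, LinearMap.add_apply, hx, hy]
  | hW c g => simp [mulLin_W, σ.phase_zero_right]

theorem one_mulLin (x : WeylAlgebra σ) : mulLin σ (W σ 0) x = x := by
  induction x using induction_W with
  | h0 => simp
  | hadd x y hx hy => rw [map_add, hx, hy]
  | hW c g => simp [mulLin_W, σ.phase_zero_left]

instance instRingWeyl : Ring (WeylAlgebra σ) :=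
  { instAddCommGroupWeyl σ with
    mul := fun x y => mulLin σ x y
    one := W σ 0
    mul_assoc := mulLin_assoc σ
    one_mul := one_mulLin σ
    mul_one := mulLin_one σ
    left_distrib := fun x y z => map_add (mulLin σ x) y z
    right_distrib := fun x y z => by
      change mulLin σ (x + y) z = mulLin σ x z + mulLin σ y z
      rw [map_add, LinearMap.add_apply]
    zero_mul := fun x => by
      change mulLin σ 0 x = 0
      rw [map_zero, LinearMap.zero_apply]
    mul_zero := fun x => map_zero (mulLin σ x) }

instance instAlgebraWeyl : Algebra ℂ (WeylAlgebra σ) :=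
  Algebra.ofModule
    (fun c x y => by
      change mulLin σ (c • x) y = c • mulLin σ x y
      rw [map_smul, LinearMap.smul_apply])
    (fun c x y => map_smul (mulLin σ x) c y)

theorem one_def : (1 : WeylAlgebra σ) = W σ 0 := rfl

/-- The Weyl relations `W(g) W(h) = exp (2 π i σ(g, h)) W(g + h)`. -/
theorem W_mul_W (g h : G) : W σ g * W σ h = σ.phase g h • W σ (g + h) := mulLin_W σ g h

/-- The involution: the conjugate-linear extension of `W(g)⋆ = W(-g)`. -/
instance instStarWeyl : Star (WeylAlgebra σ) :=
  ⟨fun x => (Finsupp.mapDomain (fun g : G => -g)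
    (Finsupp.mapRange (star : ℂ → ℂ) (star_zero ℂ) (x : G →₀ ℂ)) : G →₀ ℂ)⟩

theorem star_add_aux (x y : WeylAlgebra σ) : star (x + y) = star x + star y := by
  change Finsupp.mapDomain _ (Finsupp.mapRange (star : ℂ → ℂ) (star_zero ℂ)
    (coeff σ x + coeff σ y)) = _
  rw [Finsupp.mapRange_add (star_add (R := ℂ)), Finsupp.mapDomain_add]
  rfl

theorem star_zero_aux : star (0 : WeylAlgebra σ) = 0 := by
  change Finsupp.mapDomain _ (Finsupp.mapRange (star : ℂ → ℂ) (star_zero ℂ) (0 : G →₀ ℂ)) = _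
  rw [Finsupp.mapRange_zero, Finsupp.mapDomain_zero]
  rfl

theorem star_smul_W (c : ℂ) (g : G) : star (c • W σ g) = star c • W σ (-g) := by
  change Finsupp.mapDomain _ (Finsupp.mapRange (star : ℂ → ℂ) (star_zero ℂ)
    (c • (Finsupp.single g 1 : G →₀ ℂ))) = star c • (Finsupp.single (-g) 1 : G →₀ ℂ)
  rw [Finsupp.smul_single, Finsupp.mapRange_single, Finsupp.mapDomain_single, Finsupp.smul_single]
  simp

theorem star_W (g : G) : star (W σ g) = W σ (-g) := by
  simpa using star_smul_W σ 1 g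

instance instStarRingWeyl : StarRing (WeylAlgebra σ) where
  star_involutive x := by
    induction x using induction_W with
    | h0 => rw [star_zero_aux, star_zero_aux]
    | hadd x y hx hy => rw [star_add_aux, star_add_aux, hx, hy]
    | hW c g => rw [star_smul_W, star_smul_W, star_star, neg_neg]
  star_add := star_add_aux σ
  star_mul x y := by
    induction x using induction_W with
    | h0 => rw [zero_mul, star_zero_aux, mul_zero]
    | hadd x x' hx hx' => rw [add_mul, star_add_aux, star_add_aux, mul_add, hx, hx']
    | hW c g =>
      induction y using induction_W with
      | h0 => rw [mul_zero, star_zero_aux, zero_mul]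
      | hadd y y' hy hy' => rw [mul_add, star_add_aux, star_add_aux, add_mul, hy, hy']
      | hW d h =>
        rw [smul_mul_smul_comm, W_mul_W, smul_smul, star_smul_W, star_smul_W, star_smul_W,
          smul_mul_smul_comm, W_mul_W, smul_smul, σ.phase_neg_neg, star_mul', star_mul',
          σ.star_phase, neg_add_rev, add_comm (-h) (-g), mul_comm (star c) (star d)]

instance instStarModuleWeyl : StarModule ℂ (WeylAlgebra σ) where
  star_smul c x := by
    induction x using induction_W with
    | h0 => simp
    | hadd x y hx hy => rw [smul_add, star_add, star_add, smul_add, hx, hy]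
    | hW d g => rw [smul_smul, star_smul_W, star_smul_W, smul_smul, star_mul']

/-- The norm `‖∑ αⱼ W(gⱼ)‖₁ = ∑ |αⱼ|` (for pairwise distinct `gⱼ`). -/
def normOne (x : WeylAlgebra σ) : ℝ := (coeff σ x).sum fun _ c => ‖c‖

theorem normOne_eq_sum (x : WeylAlgebra σ) (s : Finset G)
    (hs : (coeff σ x).support ⊆ s) : normOne σ x = ∑ g ∈ s, ‖coeff σ x g‖ :=
  Finsupp.sum_of_support_subset (coeff σ x) hs _ (fun _ _ => norm_zero)

theorem normOne_nonneg (x : WeylAlgebra σ) : 0 ≤ normOne σ x :=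
  Finset.sum_nonneg fun _ _ => norm_nonneg _

theorem normOne_add_le (x y : WeylAlgebra σ) : normOne σ (x + y) ≤ normOne σ x + normOne σ y := by
  classical
  rw [normOne_eq_sum σ (x + y) ((coeff σ x).support ∪ (coeff σ y).support)
      Finsupp.support_add,
    normOne_eq_sum σ x _ Finset.subset_union_left, normOne_eq_sum σ y _ Finset.subset_union_right,
    ← Finset.sum_add_distrib]
  exact Finset.sum_le_sum fun g _ => norm_add_le (coeff σ x g) (coeff σ y g)

theorem normOne_smul (c : ℂ) (x : WeylAlgebra σ) : normOne σ (c • x) = ‖c‖ * normOne σ x := by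
  rw [normOne_eq_sum σ (c • x) ((coeff σ x).support) Finsupp.support_smul,
    normOne_eq_sum σ x _ subset_rfl, Finset.mul_sum]
  exact Finset.sum_congr rfl fun g _ => norm_mul c (coeff σ x g)

theorem normOne_W (g : G) : normOne σ (W σ g) = 1 := by
  change Finsupp.sum (Finsupp.single g (1 : ℂ)) (fun _ c => ‖c‖) = 1
  simp [Finsupp.sum_single_index]

/-- The expansion of an element of the Weyl algebra in the generators. -/
theorem eq_sum_W (x : WeylAlgebra σ) :
    x = ∑ g ∈ (coeff σ x).support, coeff σ x g • W σ g := by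
  have h : (∑ g ∈ (coeff σ x).support, coeff σ x g • (Finsupp.single g 1 : G →₀ ℂ))
      = x := by
    simp only [Finsupp.smul_single, smul_eq_mul, mul_one]
    exact Finsupp.sum_single (coeff σ x)
  exact h.symm

/-- `‖·‖₁` as a norm on the additive group of `𝒜(G)`. -/
def normOneGroupNorm : AddGroupNorm (WeylAlgebra σ) where
  toFun := normOne σ
  map_zero' := Finsupp.sum_zero_index
  add_le' := normOne_add_le σ
  neg' x := by rw [← neg_one_smul ℂ x, normOne_smul]; simp
  eq_zero_of_map_eq_zero' x hx := by
    refine Finsupp.ext fun g => ?_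
    by_contra hg
    have hmem : g ∈ (coeff σ x).support := Finsupp.mem_support_iff.mpr hg
    have h := (Finset.sum_eq_zero_iff_of_nonneg (fun g _ => norm_nonneg (coeff σ x g))).mp hx
      g hmem
    exact hg (norm_eq_zero.mp h)

theorem normOne_sum_le (s : Finset G) (f : G → WeylAlgebra σ) :
    normOne σ (∑ g ∈ s, f g) ≤ ∑ g ∈ s, normOne σ (f g) :=
  Finset.le_sum_of_subadditive (normOne σ) Finsupp.sum_zero_index.le (normOne_add_le σ) s f

theorem normOne_mul_le (x y : WeylAlgebra σ) : normOne σ (x * y) ≤ normOne σ x * normOne σ y := by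
  have key : ∀ (g : G) (y : WeylAlgebra σ), normOne σ (W σ g * y) ≤ normOne σ y := by
    intro g y
    conv_lhs => rw [eq_sum_W σ y, Finset.mul_sum]
    refine (normOne_sum_le σ _ _).trans ?_
    rw [normOne_eq_sum σ y _ subset_rfl]
    refine Finset.sum_le_sum fun h _ => ?_
    rw [mul_smul_comm, W_mul_W, normOne_smul, normOne_smul, normOne_W, σ.norm_phase, mul_one,
      mul_one]
  conv_lhs => rw [eq_sum_W σ x, Finset.sum_mul]
  refine (normOne_sum_le σ _ _).trans ?_
  rw [normOne_eq_sum σ x _ subset_rfl, Finset.sum_mul]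
  refine Finset.sum_le_sum fun g _ => ?_
  rw [smul_mul_assoc, normOne_smul]
  exact mul_le_mul_of_nonneg_left (key g y) (norm_nonneg _)

instance instNormedRingWeyl : NormedRing (WeylAlgebra σ) :=
  { instRingWeyl σ, (normOneGroupNorm σ).toNormedAddCommGroup with
    norm_mul_le := normOne_mul_le σ }

instance instNormedAlgebraWeyl : NormedAlgebra ℂ (WeylAlgebra σ) :=
  { instAlgebraWeyl σ with
    norm_smul_le := fun c x => (normOne_smul σ c x).le }

instance instNormedStarGroupWeyl : NormedStarGroup (WeylAlgebra σ) where
  norm_star_le x := by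
    change normOne σ (star x) ≤ normOne σ x
    conv_lhs => rw [eq_sum_W σ x, star_sum]
    refine (normOne_sum_le σ _ _).trans ?_
    rw [normOne_eq_sum σ x _ subset_rfl]
    refine Finset.sum_le_sum fun g _ => ?_
    rw [star_smul_W, normOne_smul, normOne_W, norm_star, mul_one]

end WeylAlgebra

/-- The Banach `*`-algebra `ℬ(G)` of a presymplectic Abelian group `(G, σ)`: the completion of
the Weyl algebra `𝒜(G)` in the norm `‖·‖₁`. -/
abbrev BanachWeylAlgebra {G : Type*} [AddCommGroup G] (σ : PresymplecticForm G) : Type _ :=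
  UniformSpace.Completion (WeylAlgebra σ)

/-- The Weyl C⋆-algebra `C⋆(ℬ(G))` of a presymplectic Abelian group `(G, σ)`. -/
abbrev WeylCStarAlgebra {G : Type*} [AddCommGroup G] (σ : PresymplecticForm G) : Type _ :=
  EnvelopingCStarAlgebra (BanachWeylAlgebra σ)

/-- The image of the generator `W(g)` in `C⋆(ℬ(G))`. -/
def weylGenerator {G : Type*} [AddCommGroup G] (σ : PresymplecticForm G) (g : G) :
    WeylCStarAlgebra σ :=
  toEnveloping ((WeylAlgebra.W σ g : WeylAlgebra σ) : BanachWeylAlgebra σ)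

end

open scoped TensorProduct

noncomputable section

/-! ### Extension of contractive `*`-homomorphisms to completions -/

namespace UniformSpace.Completion

variable {A : Type*} [SeminormedRing A] [StarRing A] [NormedAlgebra ℂ A]
  {D : Type*} [CStarAlgebra D]

/-! Both sides represent the same functor on unital C⋆-algebras `D`. A `*`-homomorphism from the
Weyl C⋆-algebra of `(G, σ)` to `D` is the same as a Weyl system in `D` (`IsWeylSystem.lift`,
`weylCStarAlgebra_ext`), and one from the maximal tensor product is a pair of `*`-homomorphisms with
commuting ranges (`maxTensorLift`, `maxTensorProduct_ext`). Since the two summands of `G₁ ⊕ G₂` are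
orthogonal, a Weyl system over the sum is a commuting pair of Weyl systems over `G₁` and `G₂`. The
isomorphism and its inverse come from the two universal properties, and generators suffice to check
that they are mutually inverse.

The analysis consists of norm bounds. The elements of a Weyl system have norm at most one, so the
induced map is contractive for `‖·‖₁`. It extends to the Banach algebra, and there it defines a
C⋆-seminorm that competes in the supremum defining the envelope. Likewise, contractivity of
`*`-homomorphisms between C⋆-algebras makes the seminorm of a commuting pair subcross. No faithful
representation is needed. -/

theorem continuous_of_norm_apply_le {f : A →⋆ₐ[ℂ] D} (hf : ∀ a, ‖f a‖ ≤ ‖a‖) : Continuous f :=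
  AddMonoidHomClass.continuous_of_bound f 1 fun a => by simpa using hf a

theorem continuous_ringHom_of_norm_apply_le {f : A →⋆ₐ[ℂ] D} (hf : ∀ a, ‖f a‖ ≤ ‖a‖) :
    Continuous (f : A →+* D) :=
  continuous_of_norm_apply_le hf

variable [NormedStarGroup A]

/-- A contractive `*`-homomorphism into a C⋆-algebra extends to the completion. -/
def starLift (f : A →⋆ₐ[ℂ] D) (hf : ∀ a, ‖f a‖ ≤ ‖a‖) : Completion A →⋆ₐ[ℂ] D :=
  { extensionHom (f : A →+* D) (continuous_ringHom_of_norm_apply_le hf) with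
    commutes' := fun c => (extensionHom_coe (f : A →+* D) (continuous_ringHom_of_norm_apply_le hf)
      (algebraMap ℂ A c)).trans (AlgHomClass.commutes f c)
    map_star' := fun x => by
      change extensionHom (f : A →+* D) (continuous_ringHom_of_norm_apply_le hf) (star x) =
        star (extensionHom (f : A →+* D) (continuous_ringHom_of_norm_apply_le hf) x)
      have hc : Continuous (extensionHom (f : A →+* D) (continuous_ringHom_of_norm_apply_le hf)) :=
        continuous_extension
      induction x using Completion.induction_on with
      | hp => exact isClosed_eq (hc.comp continuous_star_completion) (continuous_star.comp hc)
      | ih a =>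
        rw [← coe_star_completion, extensionHom_coe, extensionHom_coe]
        exact map_star f a }

theorem starLift_coe (f : A →⋆ₐ[ℂ] D) (hf : ∀ a, ‖f a‖ ≤ ‖a‖) (a : A) :
    starLift f hf (a : Completion A) = f a :=
  extensionHom_coe (f : A →+* D) (continuous_ringHom_of_norm_apply_le hf) a

/-- The bound passes to limits. It keeps the extension to the Banach algebra dominated by the norm,
as the comparison with the Gelfand–Naimark seminorm requires. -/
theorem norm_starLift_le (f : A →⋆ₐ[ℂ] D) (hf : ∀ a, ‖f a‖ ≤ ‖a‖) (x : Completion A) :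
    ‖starLift f hf x‖ ≤ ‖x‖ := by
  have hc : Continuous (starLift f hf) := continuous_extension
  induction x using Completion.induction_on with
  | hp => exact isClosed_le (continuous_norm.comp hc) continuous_norm
  | ih a => rw [starLift_coe, norm_coe]; exact hf a

end UniformSpace.Completion

/-! ### Universal property of the C⋆-algebra defined by a C⋆-seminorm -/

namespace CStarSeminorm

variable {A : Type*} [Ring A] [StarRing A] [Algebra ℂ A] {D : Type*} [CStarAlgebra D]

/-- The C⋆-seminorm `a ↦ ‖f a‖` induced by a `*`-homomorphism `f` into a C⋆-algebra. -/
def ofStarAlgHom (f : A →⋆ₐ[ℂ] D) : CStarSeminorm A where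
  toFun a := ‖f a‖
  map_zero' := by simp
  add_le' a b := by rw [map_add]; exact norm_add_le _ _
  neg' a := by rw [map_neg, norm_neg]
  smul' c a := by rw [map_smul, norm_smul]
  mul_le' a b := by rw [map_mul]; exact norm_mul_le _ _
  star_mul_self' a := by
    rw [map_mul, map_star, CStarRing.norm_star_mul_self, sq]

theorem le_lub {S : Set (CStarSeminorm A)} (hne : S.Nonempty)
    (hbd : ∀ a, BddAbove (Set.range fun p : S => (p : CStarSeminorm A) a))
    {p : CStarSeminorm A} (hp : p ∈ S) (a : A) : p a ≤ lub S hne hbd a :=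
  le_ciSup (hbd a) ⟨p, hp⟩

variable (p : CStarSeminorm A)

/-- A `*`-homomorphism dominated by `p` extends to the C⋆-algebra defined by `p`. -/
def starLift (f : A →⋆ₐ[ℂ] D) (hf : ∀ a, ‖f a‖ ≤ p a) : p.CStarCompletion →⋆ₐ[ℂ] D :=
  -- The norm of `p.Carrier` is `p` by definition, so `hf` says that `f` is contractive there.
  UniformSpace.Completion.starLift (A := p.Carrier) f hf

theorem starLift_toCompletion (f : A →⋆ₐ[ℂ] D) (hf : ∀ a, ‖f a‖ ≤ p a) (a : A) :
    p.starLift f hf (p.toCompletion a) = f a :=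
  UniformSpace.Completion.starLift_coe (A := p.Carrier) f hf a

theorem denseRange_toCompletion : DenseRange p.toCompletion :=
  UniformSpace.Completion.denseRange_coe (α := p.Carrier)

variable {p} in
/-- `*`-homomorphisms on the C⋆-algebra defined by `p` are determined on `A`. -/
theorem starAlgHom_ext [StarModule ℂ A] {f g : p.CStarCompletion →⋆ₐ[ℂ] D}
    (h : ∀ a, f (p.toCompletion a) = g (p.toCompletion a)) : f = g :=
  -- Both maps are continuous automatically, because `*`-homomorphisms between C⋆-algebras are
  -- contractive.
  DFunLike.coe_injective <| p.denseRange_toCompletion.equalizer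
    (UniformSpace.Completion.continuous_of_norm_apply_le (NonUnitalStarAlgHom.norm_apply_le f))
    (UniformSpace.Completion.continuous_of_norm_apply_le (NonUnitalStarAlgHom.norm_apply_le g))
    (funext h)

end CStarSeminorm

/-! ### Universal property of the enveloping C⋆-algebra -/

section Envelope

variable {B : Type*} [NormedRing B] [StarRing B] [NormedAlgebra ℂ B]

/-- A supremum of seminorms below the norm stays below the norm. The resulting continuity carries
density arguments from `B` to its envelope. -/
theorem norm_toEnveloping_le (b : B) : ‖toEnveloping b‖ ≤ ‖b‖ := by
  have : Nonempty {p : CStarSeminorm B | ∀ b, p b ≤ ‖b‖} :=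
    ⟨⟨CStarSeminorm.zeroSeminorm, fun b => norm_nonneg b⟩⟩
  exact ((gelfandNaimarkSeminorm B).norm_ofElem b).trans_le (ciSup_le fun p => p.2 b)

/-- The function `b ↦ ‖f b‖` is itself one of the C⋆-seminorms over which the supremum is taken. -/
theorem norm_le_gelfandNaimarkSeminorm {D : Type*} [CStarAlgebra D] {f : B →⋆ₐ[ℂ] D}
    (hf : ∀ b, ‖f b‖ ≤ ‖b‖) (b : B) : ‖f b‖ ≤ gelfandNaimarkSeminorm B b :=
  CStarSeminorm.le_lub (S := {p : CStarSeminorm B | ∀ b, p b ≤ ‖b‖}) _ _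
    (p := CStarSeminorm.ofStarAlgHom f) hf b

end Envelope

/-! ### Universal property of the maximal tensor product -/

section MaxTensor

variable {C₁ C₂ D : Type*} [CStarAlgebra C₁] [CStarAlgebra C₂] [CStarAlgebra D]

theorem maxTmul_mul_maxTmul (a₁ b₁ : C₁) (a₂ b₂ : C₂) :
    maxTmul a₁ a₂ * maxTmul b₁ b₂ = maxTmul (a₁ * b₁) (a₂ * b₂) := by
  rw [maxTmul, maxTmul, ← map_mul, Algebra.TensorProduct.tmul_mul_tmul]

/-- Commuting `*`-homomorphisms define a `*`-homomorphism on the algebraic tensor product. -/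
def tensorStarLift (f₁ : C₁ →⋆ₐ[ℂ] D) (f₂ : C₂ →⋆ₐ[ℂ] D)
    (h : ∀ c₁ c₂, Commute (f₁ c₁) (f₂ c₂)) : C₁ ⊗[ℂ] C₂ →⋆ₐ[ℂ] D :=
  { Algebra.TensorProduct.lift (f₁ : C₁ →ₐ[ℂ] D) (f₂ : C₂ →ₐ[ℂ] D) h with
    map_star' := fun t => by
      change Algebra.TensorProduct.lift (f₁ : C₁ →ₐ[ℂ] D) (f₂ : C₂ →ₐ[ℂ] D) h (star t) =
        star (Algebra.TensorProduct.lift (f₁ : C₁ →ₐ[ℂ] D) (f₂ : C₂ →ₐ[ℂ] D) h t)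
      induction t using TensorProduct.induction_on with
      | zero => simp
      | add s t hs ht => rw [star_add, map_add, map_add, star_add, hs, ht]
      | tmul c₁ c₂ =>
        rw [TensorProduct.star_tmul, Algebra.TensorProduct.lift_tmul,
          Algebra.TensorProduct.lift_tmul, star_mul]
        change f₁ (star c₁) * f₂ (star c₂) = star (f₂ c₂) * star (f₁ c₁)
        -- The involution reverses the order of the factors; commutation of the two ranges restores
        -- it.
        rw [(h _ _).eq, map_star, map_star] }

theorem tensorStarLift_tmul (f₁ : C₁ →⋆ₐ[ℂ] D) (f₂ : C₂ →⋆ₐ[ℂ] D)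
    (h : ∀ c₁ c₂, Commute (f₁ c₁) (f₂ c₂)) (c₁ : C₁) (c₂ : C₂) :
    tensorStarLift f₁ f₂ h (c₁ ⊗ₜ c₂) = f₁ c₁ * f₂ c₂ :=
  Algebra.TensorProduct.lift_tmul (f₁ : C₁ →ₐ[ℂ] D) (f₂ : C₂ →ₐ[ℂ] D) h c₁ c₂

/-- Commuting `*`-homomorphisms into a C⋆-algebra define a `*`-homomorphism on the maximal tensor
product. -/
def maxTensorLift (f₁ : C₁ →⋆ₐ[ℂ] D) (f₂ : C₂ →⋆ₐ[ℂ] D)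
    (h : ∀ c₁ c₂, Commute (f₁ c₁) (f₂ c₂)) : MaxTensorProduct C₁ C₂ →⋆ₐ[ℂ] D :=
  (maxTensorSeminorm C₁ C₂).starLift (tensorStarLift f₁ f₂ h) fun t =>
    -- The seminorm `t ↦ ‖(f₁ ⊗ f₂) t‖` is subcross because `f₁` and `f₂` are contractive, so the
    -- maximal seminorm dominates it.
    CStarSeminorm.le_lub _ _ (p := CStarSeminorm.ofStarAlgHom (tensorStarLift f₁ f₂ h))
      (fun c₁ c₂ => by
        change ‖tensorStarLift f₁ f₂ h (c₁ ⊗ₜ c₂)‖ ≤ _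
        rw [tensorStarLift_tmul]
        exact (norm_mul_le _ _).trans (mul_le_mul (NonUnitalStarAlgHom.norm_apply_le f₁ c₁)
          (NonUnitalStarAlgHom.norm_apply_le f₂ c₂) (norm_nonneg _) (norm_nonneg _))) t

theorem maxTensorLift_maxTmul (f₁ : C₁ →⋆ₐ[ℂ] D) (f₂ : C₂ →⋆ₐ[ℂ] D)
    (h : ∀ c₁ c₂, Commute (f₁ c₁) (f₂ c₂)) (c₁ : C₁) (c₂ : C₂) :
    maxTensorLift f₁ f₂ h (maxTmul c₁ c₂) = f₁ c₁ * f₂ c₂ :=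
  (CStarSeminorm.starLift_toCompletion _ _ _ _).trans (tensorStarLift_tmul f₁ f₂ h c₁ c₂)

/-- The factorization `c₁ ⊗ c₂ = (c₁ ⊗ 1)(1 ⊗ c₂)` shows that the two legs generate a dense
subalgebra. -/
theorem maxTensorProduct_ext {f g : MaxTensorProduct C₁ C₂ →⋆ₐ[ℂ] D}
    (h₁ : ∀ c, f (maxTmul c 1) = g (maxTmul c 1)) (h₂ : ∀ c, f (maxTmul 1 c) = g (maxTmul 1 c)) :
    f = g := by
  refine CStarSeminorm.starAlgHom_ext fun t => ?_
  induction t using TensorProduct.induction_on with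
  | zero => simp only [map_zero]
  | add s t hs ht => simp only [map_add, hs, ht]
  | tmul c₁ c₂ =>
    have e : maxTmul c₁ c₂ = maxTmul c₁ 1 * maxTmul 1 c₂ := by
      rw [maxTmul_mul_maxTmul, mul_one, one_mul]
    change f (maxTmul c₁ c₂) = g (maxTmul c₁ c₂)
    rw [e, map_mul, map_mul, h₁, h₂]

variable (C₁ C₂) in
/-- The canonical `*`-homomorphism `c ↦ c ⊗ 1`. -/
def maxTensorInl : C₁ →⋆ₐ[ℂ] MaxTensorProduct C₁ C₂ :=
  { ((maxTensorSeminorm C₁ C₂).toCompletion : C₁ ⊗[ℂ] C₂ →ₐ[ℂ] _).comp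
      (Algebra.TensorProduct.includeLeft : C₁ →ₐ[ℂ] C₁ ⊗[ℂ] C₂) with
    map_star' := fun c => by
      change maxTmul (star c) 1 = star (maxTmul c 1)
      rw [maxTmul, maxTmul, ← map_star, TensorProduct.star_tmul, star_one] }

variable (C₁ C₂) in
/-- The canonical `*`-homomorphism `c ↦ 1 ⊗ c`. -/
def maxTensorInr : C₂ →⋆ₐ[ℂ] MaxTensorProduct C₁ C₂ :=
  { ((maxTensorSeminorm C₁ C₂).toCompletion : C₁ ⊗[ℂ] C₂ →ₐ[ℂ] _).comp
      (Algebra.TensorProduct.includeRight : C₂ →ₐ[ℂ] C₁ ⊗[ℂ] C₂) with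
    map_star' := fun c => by
      change maxTmul 1 (star c) = star (maxTmul 1 c)
      rw [maxTmul, maxTmul, ← map_star, TensorProduct.star_tmul, star_one] }

theorem maxTensorInl_apply (c : C₁) : maxTensorInl C₁ C₂ c = maxTmul c 1 := rfl

theorem maxTensorInr_apply (c : C₂) : maxTensorInr C₁ C₂ c = maxTmul 1 c := rfl

end MaxTensor

/-! ### Universal property of the Weyl C⋆-algebra -/

/-- A Weyl system over `(G, σ)` in a C⋆-algebra: a family of elements satisfying the Weyl
relations. -/
structure IsWeylSystem {G D : Type*} [AddCommGroup G] [CStarAlgebra D] (σ : PresymplecticForm G)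
    (u : G → D) : Prop where
  map_zero : u 0 = 1
  star_apply : ∀ g, star (u g) = u (-g)
  mul_apply : ∀ g h, u g * u h = σ.phase g h • u (g + h)

namespace IsWeylSystem

variable {G D : Type*} [AddCommGroup G] [CStarAlgebra D] {σ : PresymplecticForm G} {u : G → D}

/-- By the C⋆-identity, `‖u g‖² = ‖u(-g) u(g)‖ = ‖1‖`, since the phase has modulus one. Unitarity of
`u g` is not available a priori: antisymmetry permits `σ(g, g) = 1/2`, in which case `u(g)⋆ u(g) =
-1`. -/
theorem norm_le_one (hu : IsWeylSystem σ u) (g : G) : ‖u g‖ ≤ 1 := by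
  -- Only an inequality, because `D` may be the zero algebra.
  have h1 : ‖(1 : D)‖ ≤ 1 := by
    nontriviality D
    exact CStarRing.norm_one.le
  have h2 : ‖u g‖ * ‖u g‖ = ‖(1 : D)‖ := by
    rw [← CStarRing.norm_star_mul_self, hu.star_apply, hu.mul_apply, neg_add_cancel, hu.map_zero,
      norm_smul, σ.norm_phase, one_mul]
  nlinarith [norm_nonneg (u g)]

variable (σ u) in
/-- The linear extension of a family `u` to the Weyl algebra. -/
def linearLift : WeylAlgebra σ →ₗ[ℂ] D :=
  (Finsupp.linearCombination ℂ u : (G →₀ ℂ) →ₗ[ℂ] D)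

theorem linearLift_W (g : G) : linearLift σ u (WeylAlgebra.W σ g) = u g :=
  (Finsupp.linearCombination_single ℂ 1 g).trans (one_smul _ _)

/-- The `*`-homomorphism on the Weyl algebra defined by a Weyl system. -/
def weylLift (hu : IsWeylSystem σ u) : WeylAlgebra σ →⋆ₐ[ℂ] D :=
  { AlgHom.ofLinearMap (linearLift σ u)
      (by rw [WeylAlgebra.one_def, linearLift_W, hu.map_zero])
      (fun x y => by
        induction x using WeylAlgebra.induction_W with
        | h0 => simp
        | hadd x x' hx hx' => rw [add_mul, map_add, map_add, add_mul, hx, hx']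
        | hW c g =>
          induction y using WeylAlgebra.induction_W with
          | h0 => simp
          | hadd y y' hy hy' => rw [mul_add, map_add, map_add, mul_add, hy, hy']
          | hW d h =>
            simp only [smul_mul_smul_comm, WeylAlgebra.W_mul_W, map_smul, linearLift_W,
              hu.mul_apply]) with
    map_star' := fun x => by
      change linearLift σ u (star x) = star (linearLift σ u x)
      induction x using WeylAlgebra.induction_W with
      | h0 => simp
      | hadd x y hx hy => rw [star_add, map_add, map_add, star_add, hx, hy]
      | hW c g =>
        rw [WeylAlgebra.star_smul_W, map_smul, map_smul, linearLift_W, linearLift_W, star_smul,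
          hu.star_apply] }

theorem weylLift_W (hu : IsWeylSystem σ u) (g : G) : hu.weylLift (WeylAlgebra.W σ g) = u g :=
  linearLift_W g

/-- The triangle inequality suffices: each generator goes to an element of norm at most one, and
`‖·‖₁` is the sum of the moduli of the coefficients. -/
theorem norm_weylLift_le (hu : IsWeylSystem σ u) (x : WeylAlgebra σ) : ‖hu.weylLift x‖ ≤ ‖x‖ := by
  change _ ≤ WeylAlgebra.normOne σ x
  conv_lhs => rw [WeylAlgebra.eq_sum_W σ x, map_sum]
  refine (norm_sum_le _ _).trans ?_
  rw [WeylAlgebra.normOne_eq_sum σ x _ subset_rfl]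
  refine Finset.sum_le_sum fun g _ => ?_
  rw [map_smul, weylLift_W, norm_smul]
  exact mul_le_of_le_one_right (norm_nonneg _) (hu.norm_le_one g)

/-- The `*`-homomorphism on the Weyl C⋆-algebra defined by a Weyl system. -/
def lift (hu : IsWeylSystem σ u) : WeylCStarAlgebra σ →⋆ₐ[ℂ] D :=
  -- Two extensions in succession: from the Weyl algebra to its `‖·‖₁`-completion, then to the
  -- enveloping C⋆-algebra.
  (gelfandNaimarkSeminorm (BanachWeylAlgebra σ)).starLift
    (UniformSpace.Completion.starLift hu.weylLift hu.norm_weylLift_le)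
    (norm_le_gelfandNaimarkSeminorm
      (UniformSpace.Completion.norm_starLift_le hu.weylLift hu.norm_weylLift_le))

theorem lift_weylGenerator (hu : IsWeylSystem σ u) (g : G) : hu.lift (weylGenerator σ g) = u g :=
  ((CStarSeminorm.starLift_toCompletion _ _ _ _).trans
    (UniformSpace.Completion.starLift_coe _ _ _)).trans (hu.weylLift_W g)

end IsWeylSystem

section WeylCStarAlgebra

variable {G D : Type*} [AddCommGroup G] [CStarAlgebra D] (σ : PresymplecticForm G)

/-- The Weyl relations survive the `*`-homomorphisms from the Weyl algebra to its completion and on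
to the envelope; this is the universal Weyl system. -/
theorem isWeylSystem_weylGenerator : IsWeylSystem σ (weylGenerator σ) where
  map_zero := by
    rw [weylGenerator, ← WeylAlgebra.one_def, UniformSpace.Completion.coe_one, map_one]
  star_apply g := by
    rw [weylGenerator, weylGenerator, ← map_star, ← UniformSpace.Completion.coe_star_completion,
      WeylAlgebra.star_W]
  mul_apply g h := by
    rw [weylGenerator, weylGenerator, weylGenerator, ← map_mul, ← UniformSpace.Completion.coe_mul,
      WeylAlgebra.W_mul_W, UniformSpace.Completion.coe_smul, map_smul]

variable {σ}

/-- A closed property stable under linear combinations that holds for the generators holds on the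
whole Weyl C⋆-algebra. -/
theorem weylCStarAlgebra_induction {P : WeylCStarAlgebra σ → Prop}
    (hc : IsClosed {x | P x}) (hadd : ∀ x y, P x → P y → P (x + y))
    (hsmul : ∀ (c : ℂ) x, P x → P (c • x)) (hW : ∀ g, P (weylGenerator σ g))
    (x : WeylCStarAlgebra σ) : P x := by
  have hcont : Continuous (toEnveloping : BanachWeylAlgebra σ →⋆ₐ[ℂ] WeylCStarAlgebra σ) :=
    UniformSpace.Completion.continuous_of_norm_apply_le norm_toEnveloping_le
  -- Density is used twice: the Banach algebra is dense in its envelope, and the Weyl algebra is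
  -- dense in the Banach algebra.
  refine (CStarSeminorm.denseRange_toCompletion _).induction_on x hc fun b => ?_
  induction b using UniformSpace.Completion.induction_on with
  | hp => exact hc.preimage hcont
  | ih a =>
    induction a using WeylAlgebra.induction_W with
    | h0 =>
      -- `P 0` is not assumed; it follows from `0 = 0 • W(0)`.
      rw [UniformSpace.Completion.coe_zero, map_zero, ← zero_smul ℂ (weylGenerator σ 0)]
      exact hsmul _ _ (hW 0)
    | hadd x y hx hy =>
      rw [UniformSpace.Completion.coe_add, map_add]
      exact hadd _ _ hx hy
    | hW c g =>
      rw [UniformSpace.Completion.coe_smul, map_smul]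
      exact hsmul _ _ (hW g)

theorem weylCStarAlgebra_ext {f g : WeylCStarAlgebra σ →⋆ₐ[ℂ] D}
    (h : ∀ a, f (weylGenerator σ a) = g (weylGenerator σ a)) : f = g := by
  refine StarAlgHom.ext fun x => ?_
  induction x using weylCStarAlgebra_induction with
  | hc =>
    exact isClosed_eq
      (UniformSpace.Completion.continuous_of_norm_apply_le (NonUnitalStarAlgHom.norm_apply_le f))
      (UniformSpace.Completion.continuous_of_norm_apply_le (NonUnitalStarAlgHom.norm_apply_le g))
  | hadd x y hx hy => rw [map_add, map_add, hx, hy]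
  | hsmul c x hx => rw [map_smul, map_smul, hx]
  | hW a => exact h a

/-- `*`-homomorphisms on Weyl C⋆-algebras commute if they commute on generators. -/
theorem commute_of_commute_weylGenerator {G' : Type*} [AddCommGroup G'] {σ' : PresymplecticForm G'}
    (f : WeylCStarAlgebra σ →⋆ₐ[ℂ] D) (f' : WeylCStarAlgebra σ' →⋆ₐ[ℂ] D)
    (h : ∀ g g', Commute (f (weylGenerator σ g)) (f' (weylGenerator σ' g')))
    (x : WeylCStarAlgebra σ) (y : WeylCStarAlgebra σ') : Commute (f x) (f' y) := by
  have hf : Continuous f :=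
    UniformSpace.Completion.continuous_of_norm_apply_le (NonUnitalStarAlgHom.norm_apply_le f)
  have hf' : Continuous f' :=
    UniformSpace.Completion.continuous_of_norm_apply_le (NonUnitalStarAlgHom.norm_apply_le f')
  -- Commutation is a closed linear condition in each variable separately, so each is reduced to
  -- generators in turn.
  induction x using weylCStarAlgebra_induction with
  | hc => exact isClosed_eq (hf.mul continuous_const) (continuous_const.mul hf)
  | hadd x x' hx hx' => rw [map_add]; exact hx.add_left hx'
  | hsmul c x hx => rw [map_smul]; exact hx.smul_left c
  | hW g =>
    induction y using weylCStarAlgebra_induction with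
    | hc => exact isClosed_eq (continuous_const.mul hf') (hf'.mul continuous_const)
    | hadd y y' hy hy' => rw [map_add]; exact hy.add_right hy'
    | hsmul c y hy => rw [map_smul]; exact hy.smul_right c
    | hW g' => exact h g g'

end WeylCStarAlgebra

/-! ### The Weyl C⋆-algebra of an orthogonal sum -/

section OrthogonalSum

variable {G₁ G₂ : Type*} [AddCommGroup G₁] [AddCommGroup G₂]
  (σ₁ : PresymplecticForm G₁) (σ₂ : PresymplecticForm G₂)

theorem phase_orthogonalSum (x y : G₁ × G₂) :
    (σ₁.orthogonalSum σ₂).phase x y = σ₁.phase x.1 y.1 * σ₂.phase x.2 y.2 := by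
  simp [PresymplecticForm.phase, PresymplecticForm.orthogonalSum_apply, AddCircle.toCircle_add]

/-- The phase of the orthogonal sum is the product of the two phases, which is the scalar produced
by multiplying elementary tensors legwise. -/
theorem isWeylSystem_maxTmul :
    IsWeylSystem (σ₁.orthogonalSum σ₂)
      fun x : G₁ × G₂ => maxTmul (weylGenerator σ₁ x.1) (weylGenerator σ₂ x.2) where
  map_zero := by
    rw [Prod.fst_zero, Prod.snd_zero, (isWeylSystem_weylGenerator σ₁).map_zero,
      (isWeylSystem_weylGenerator σ₂).map_zero]
    exact map_one (maxTensorSeminorm _ _).toCompletion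
  star_apply x := by
    rw [Prod.fst_neg, Prod.snd_neg, ← (isWeylSystem_weylGenerator σ₁).star_apply,
      ← (isWeylSystem_weylGenerator σ₂).star_apply, maxTmul, maxTmul, ← map_star,
      TensorProduct.star_tmul]
  mul_apply x y := by
    rw [maxTmul_mul_maxTmul, (isWeylSystem_weylGenerator σ₁).mul_apply,
      (isWeylSystem_weylGenerator σ₂).mul_apply, phase_orthogonalSum, maxTmul, maxTmul,
      TensorProduct.smul_tmul_smul, map_smul, Prod.fst_add, Prod.snd_add]

/-- The inclusion `g ↦ (g, 0)` preserves the form, as the second summand contributes `σ₂(0, 0) = 0`.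
-/
theorem isWeylSystem_inl :
    IsWeylSystem σ₁ fun g : G₁ => weylGenerator (σ₁.orthogonalSum σ₂) (g, (0 : G₂)) where
  map_zero := (isWeylSystem_weylGenerator _).map_zero
  star_apply g := by
    rw [(isWeylSystem_weylGenerator _).star_apply, Prod.neg_mk, neg_zero]
  mul_apply g h := by
    rw [(isWeylSystem_weylGenerator _).mul_apply, phase_orthogonalSum, σ₂.phase_zero_left, mul_one,
      Prod.mk_add_mk, add_zero]

theorem isWeylSystem_inr :
    IsWeylSystem σ₂ fun g : G₂ => weylGenerator (σ₁.orthogonalSum σ₂) ((0 : G₁), g) where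
  map_zero := (isWeylSystem_weylGenerator _).map_zero
  star_apply g := by
    rw [(isWeylSystem_weylGenerator _).star_apply, Prod.neg_mk, neg_zero]
  mul_apply g h := by
    rw [(isWeylSystem_weylGenerator _).mul_apply, phase_orthogonalSum, σ₁.phase_zero_left, one_mul,
      Prod.mk_add_mk, add_zero]

/-- Orthogonality of the summands makes the phase trivial. The same holds in the opposite order, so
generators from different summands commute. -/
theorem weylGenerator_inl_mul_inr (g₁ : G₁) (g₂ : G₂) :
    weylGenerator (σ₁.orthogonalSum σ₂) (g₁, 0) * weylGenerator (σ₁.orthogonalSum σ₂) (0, g₂) =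
      weylGenerator (σ₁.orthogonalSum σ₂) (g₁, g₂) := by
  rw [(isWeylSystem_weylGenerator _).mul_apply, phase_orthogonalSum, σ₁.phase_zero_right,
    σ₂.phase_zero_left, mul_one, one_smul, Prod.mk_add_mk, add_zero, zero_add]

theorem weylGenerator_inr_mul_inl (g₁ : G₁) (g₂ : G₂) :
    weylGenerator (σ₁.orthogonalSum σ₂) (0, g₂) * weylGenerator (σ₁.orthogonalSum σ₂) (g₁, 0) =
      weylGenerator (σ₁.orthogonalSum σ₂) (g₁, g₂) := by
  rw [(isWeylSystem_weylGenerator _).mul_apply, phase_orthogonalSum, σ₁.phase_zero_left,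
    σ₂.phase_zero_right, mul_one, one_smul, Prod.mk_add_mk, add_zero, zero_add]

/-- The `*`-homomorphism `W(g₁, g₂) ↦ W(g₁) ⊗ W(g₂)`. -/
def weylToMaxTensor : WeylCStarAlgebra (σ₁.orthogonalSum σ₂) →⋆ₐ[ℂ]
    MaxTensorProduct (WeylCStarAlgebra σ₁) (WeylCStarAlgebra σ₂) :=
  (isWeylSystem_maxTmul σ₁ σ₂).lift

theorem weylToMaxTensor_weylGenerator (x : G₁ × G₂) :
    weylToMaxTensor σ₁ σ₂ (weylGenerator (σ₁.orthogonalSum σ₂) x) =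
      maxTmul (weylGenerator σ₁ x.1) (weylGenerator σ₂ x.2) :=
  (isWeylSystem_maxTmul σ₁ σ₂).lift_weylGenerator x

/-- The `*`-homomorphism `W(g₁) ⊗ W(g₂) ↦ W(g₁, 0) W(0, g₂)`. -/
def maxTensorToWeyl : MaxTensorProduct (WeylCStarAlgebra σ₁) (WeylCStarAlgebra σ₂) →⋆ₐ[ℂ]
    WeylCStarAlgebra (σ₁.orthogonalSum σ₂) :=
  maxTensorLift (isWeylSystem_inl σ₁ σ₂).lift (isWeylSystem_inr σ₁ σ₂).lift <|
    commute_of_commute_weylGenerator _ _ fun g₁ g₂ => by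
      rw [IsWeylSystem.lift_weylGenerator, IsWeylSystem.lift_weylGenerator, Commute, SemiconjBy,
        weylGenerator_inl_mul_inr, weylGenerator_inr_mul_inl]

theorem maxTensorToWeyl_maxTmul (x : WeylCStarAlgebra σ₁) (y : WeylCStarAlgebra σ₂) :
    maxTensorToWeyl σ₁ σ₂ (maxTmul x y) =
      (isWeylSystem_inl σ₁ σ₂).lift x * (isWeylSystem_inr σ₁ σ₂).lift y :=
  maxTensorLift_maxTmul _ _ _ x y

/-- On generators, `W(g₁, g₂) ↦ W(g₁) ⊗ W(g₂) ↦ W(g₁, 0) W(0, g₂) = W(g₁, g₂)`. -/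
theorem maxTensorToWeyl_comp_weylToMaxTensor :
    (maxTensorToWeyl σ₁ σ₂).comp (weylToMaxTensor σ₁ σ₂) = StarAlgHom.id ℂ _ :=
  weylCStarAlgebra_ext fun x => by
    rw [StarAlgHom.comp_apply, weylToMaxTensor_weylGenerator, maxTensorToWeyl_maxTmul,
      IsWeylSystem.lift_weylGenerator, IsWeylSystem.lift_weylGenerator, weylGenerator_inl_mul_inr]
    rfl

theorem weylToMaxTensor_comp_maxTensorToWeyl :
    (weylToMaxTensor σ₁ σ₂).comp (maxTensorToWeyl σ₁ σ₂) = StarAlgHom.id ℂ _ := by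
  -- It is enough to compare the maps on each leg. A leg is a Weyl C⋆-algebra, so generators decide,
  -- and `W(0) = 1` turns `W(g) ⊗ W(0)` into `W(g) ⊗ 1`.
  have h₁ : (weylToMaxTensor σ₁ σ₂).comp (isWeylSystem_inl σ₁ σ₂).lift =
      maxTensorInl (WeylCStarAlgebra σ₁) (WeylCStarAlgebra σ₂) :=
    weylCStarAlgebra_ext fun g => by
      rw [StarAlgHom.comp_apply, IsWeylSystem.lift_weylGenerator, weylToMaxTensor_weylGenerator,
        maxTensorInl_apply, (isWeylSystem_weylGenerator σ₂).map_zero]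
  have h₂ : (weylToMaxTensor σ₁ σ₂).comp (isWeylSystem_inr σ₁ σ₂).lift =
      maxTensorInr (WeylCStarAlgebra σ₁) (WeylCStarAlgebra σ₂) :=
    weylCStarAlgebra_ext fun g => by
      rw [StarAlgHom.comp_apply, IsWeylSystem.lift_weylGenerator, weylToMaxTensor_weylGenerator,
        maxTensorInr_apply, (isWeylSystem_weylGenerator σ₁).map_zero]
  refine maxTensorProduct_ext (fun c => ?_) (fun c => ?_)
  · rw [StarAlgHom.comp_apply, maxTensorToWeyl_maxTmul, map_one, mul_one]
    exact DFunLike.congr_fun h₁ c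
  · rw [StarAlgHom.comp_apply, maxTensorToWeyl_maxTmul, map_one, one_mul]
    exact DFunLike.congr_fun h₂ c

/-- The canonical isomorphism `C⋆(ℬ(G₁ ⊕ G₂)) ≃ C⋆(ℬ(G₁)) ⊗ C⋆(ℬ(G₂))`. -/
def weylEquivMaxTensor : WeylCStarAlgebra (σ₁.orthogonalSum σ₂) ≃⋆ₐ[ℂ]
    MaxTensorProduct (WeylCStarAlgebra σ₁) (WeylCStarAlgebra σ₂) :=
  StarAlgEquiv.ofStarAlgHom (weylToMaxTensor σ₁ σ₂) (maxTensorToWeyl σ₁ σ₂)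
    (maxTensorToWeyl_comp_weylToMaxTensor σ₁ σ₂) (weylToMaxTensor_comp_maxTensorToWeyl σ₁ σ₂)

end OrthogonalSum

end

/-! ### Existence and uniqueness of the canonical isomorphism -/

theorem mainTheorem6 {G₁ G₂ : Type*} [AddCommGroup G₁] [AddCommGroup G₂]
    (σ₁ : PresymplecticForm G₁) (σ₂ : PresymplecticForm G₂) :
    ∃! Φ : WeylCStarAlgebra (σ₁.orthogonalSum σ₂) ≃⋆ₐ[ℂ]
        MaxTensorProduct (WeylCStarAlgebra σ₁) (WeylCStarAlgebra σ₂),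
      ∀ (g₁ : G₁) (g₂ : G₂),
        Φ (weylGenerator (σ₁.orthogonalSum σ₂) (g₁, g₂)) =
          maxTmul (weylGenerator σ₁ g₁) (weylGenerator σ₂ g₂) := by
  refine ⟨weylEquivMaxTensor σ₁ σ₂, fun g₁ g₂ => weylToMaxTensor_weylGenerator σ₁ σ₂ (g₁, g₂),
    fun Ψ hΨ => ?_⟩
  -- Uniqueness holds already among `*`-homomorphisms, since values on the generators determine
  -- them.
  have h : (Ψ : WeylCStarAlgebra (σ₁.orthogonalSum σ₂) →⋆ₐ[ℂ] _) = weylToMaxTensor σ₁ σ₂ :=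
    weylCStarAlgebra_ext fun x =>
      (hΨ x.1 x.2).trans (weylToMaxTensor_weylGenerator σ₁ σ₂ x).symm
  exact StarAlgEquiv.ext fun x => DFunLike.congr_fun h x
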